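/- Let $\mathcal A=\{H_1,\dots,H_l\}$ be an ordered arrangement of distinct hyperplanes in $\mathbb{CP}^n$, where $H_i$ is the zero set of a nonzero linear form $\alpha_i$ on $\mathbb C^{n+1}$. Let $E$ be the exterior algebra of $\mathbb C^l$ with canonical generators $x_1,\dots,x_l$. The Orlik–Solomon algebra of $\mathcal A$ is $A=E/K$, where $K$ is the two-sided ideal generated by the elements $\sum_{j=1}^m(-1)^j x_{i_1}\wedge\cdots\wedge\widehat{x_{i_j}}\wedge\cdots\wedge x_{i_m}$ for all distinct indices $i_1,\dots,i_m$ such that $H_{i_1}\cap\cdots\cap H_{i_m}\neq\emptyset$ and $\alpha_{i_1},\dots,\alpha_{i_m}$ are linearly dependent, together with the monomials $x_{i_1}\wedge\cdots\wedge x_{i_m}$ for all distinct indices with $H_{i_1}\cap\cdots\cap H_{i_m}=\emptyset$. An NBC monomial is the class in $A$ of $x_{i_1}\wedge\cdots\wedge x_{i_k}$, where $0\le k\le n$, $i_1<\cdots<i_k$, the forms $\alpha_{i_1},\dots,\alpha_{i_k}$ are linearly independent and, for every $1\le j\le k$, $i_j$ is the least index $m$ with $H_m\supseteq H_{i_j}\cap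 H_{i_{j+1}}\cap\cdots\cap H_{i_k}$. Then the NBC monomials (one for each such index tuple) form a basis of the complex vector space $A$. Moreover, let $w_1,\dots,w_n\in\mathbb C^l$, identified with linear combinations of $x_1,\dots,x_l$, and let $v_i\in\mathbb C^n$ $(1\le i\le l)$ be the columns of the $n\times l$ matrix whose rows are $w_1,\dots,w_n$. In the expansion of the product $w_1\wedge\cdots\wedge w_n\in A$ in this basis only NBC monomials of degree $n$ occur, and the coefficient of the NBC monomial $x_{i_1}\wedge\cdots\wedge x_{i_n}$ is the determinant $$\det\Bigl(\ \sum_{H_i\supseteq \bigcap_{j=1}^{n}H_{i_j}}v_i\ ,\ \sum_{H_i\supseteq\bigcap_{j=2}^{n}H_{i_j}}v_i\ ,\ \dots\ ,\ \sum_{H_i\supseteq H_{i_{n-1}}\cap H_{i_n}}v_i\ ,\ v_{i_n}\Bigr),$$ that is, of the $n\times n$ matrix whose $k$-th column is $\sum v_i$ over all $i$ with $H_i\supseteq\bigcap_{j=k}^{n}H_{i_j}$, for $k=1,\dots,n$. -/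

import Mathlib

noncomputable section

/-- The hyperplane of complex projective `n`-space with equation `f = 0`. -/
def projHyperplane {n : ℕ} (f : Module.Dual ℂ (Fin (n + 1) → ℂ)) :
    Set (Projectivization ℂ (Fin (n + 1) → ℂ)) :=
  {p | p.submodule ≤ LinearMap.ker f}

/-- An ordered arrangement of `l` distinct hyperplanes in complex projective `n`-space, each
given by a (nonzero) defining linear form in the homogeneous coordinates. -/
structure ProjArrangement (n l : ℕ) where
  form : Fin l → Module.Dual ℂ (Fin (n + 1) → ℂ)
  form_ne_zero : ∀ i, form i ≠ 0
  distinct : Function.Injective fun i => projHyperplane (form i)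

namespace ProjArrangement

variable {n l : ℕ} (A : ProjArrangement n l)

/-- The `i`-th hyperplane `H_i`. -/
def hyperplane (i : Fin l) : Set (Projectivization ℂ (Fin (n + 1) → ℂ)) :=
  projHyperplane (A.form i)

/-- The intersection `H_{i_1} ∩ ⋯ ∩ H_{i_k}` of a tuple of hyperplanes. -/
def inter {k : ℕ} (i : Fin k → Fin l) : Set (Projectivization ℂ (Fin (n + 1) → ℂ)) :=
  ⋂ j, A.hyperplane (i j)

/-- The tail intersection `H_{i_j} ∩ H_{i_{j+1}} ∩ ⋯ ∩ H_{i_k}`. -/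
def tailInter {k : ℕ} (i : Fin k → Fin l) (j : Fin k) :
    Set (Projectivization ℂ (Fin (n + 1) → ℂ)) :=
  ⋂ r, ⋂ (_ : j ≤ r), A.hyperplane (i r)

/-- The hyperplanes `H_{i_1}, …, H_{i_k}` intersect non-generically: they meet, and their defining
forms are linearly dependent (the codimension of the intersection is less than `k`). -/
def NonGeneric {k : ℕ} (i : Fin k → Fin l) : Prop :=
  (A.inter i).Nonempty ∧ ¬ LinearIndependent ℂ fun j => A.form (i j)

/-- The monomial `x_{i_1} ∧ ⋯ ∧ x_{i_k}` in the exterior algebra `E` of `ℂ^l`. -/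
def extMonomial {l k : ℕ} (i : Fin k → Fin l) : ExteriorAlgebra ℂ (Fin l → ℂ) :=
  ExteriorAlgebra.ιMulti ℂ k fun j => Pi.single (i j) (1 : ℂ)

/-- `∂(x_{i_1} ∧ ⋯ ∧ x_{i_m}) = ∑_j (-1)^j x_{i_1} ∧ ⋯ (omit x_{i_j}) ⋯ ∧ x_{i_m}` for
`m = p + 1`. The position `j` is counted from `0` here, hence the exponent `j + 1`. -/
def extBoundary {l p : ℕ} (i : Fin (p + 1) → Fin l) : ExteriorAlgebra ℂ (Fin l → ℂ) :=
  ∑ j : Fin (p + 1), (-1 : ℂ) ^ ((j : ℕ) + 1) • extMonomial fun r => i (j.succAbove r)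

/-- The Orlik-Solomon ideal `K` of `E`. -/
def osIdeal : TwoSidedIdeal (ExteriorAlgebra ℂ (Fin l → ℂ)) :=
  TwoSidedIdeal.span
    ({y | ∃ (p : ℕ) (i : Fin (p + 1) → Fin l), Function.Injective i ∧ A.NonGeneric i ∧
        y = extBoundary i} ∪
     {y | ∃ (m : ℕ) (i : Fin m → Fin l), Function.Injective i ∧ A.inter i = ∅ ∧
        y = extMonomial i})

/-- The Orlik-Solomon algebra `E / K`. -/
abbrev OSAlgebra : Type := A.osIdeal.ringCon.Quotient

/-- The quotient map `E → E / K`. -/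
def toOS : ExteriorAlgebra ℂ (Fin l → ℂ) →+* A.OSAlgebra := A.osIdeal.ringCon.mk'

/-- The product `w_1 ∧ ⋯ ∧ w_k` in the Orlik-Solomon algebra of vectors of `A^1 = ℂ^l`. -/
def wedge {k : ℕ} (w : Fin k → Fin l → ℂ) : A.OSAlgebra :=
  A.toOS (ExteriorAlgebra.ιMulti ℂ k w)

/-- The monomial `x_{i_1} ∧ ⋯ ∧ x_{i_k}` in the Orlik-Solomon algebra. -/
def monomial {k : ℕ} (i : Fin k → Fin l) : A.OSAlgebra :=
  A.wedge fun j => Pi.single (i j) (1 : ℂ)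

/-- The index tuple `i_1 < ⋯ < i_k` satisfies the non-broken-circuit conditions. -/
structure IsNBC {k : ℕ} (i : Fin k → Fin l) : Prop where
  le_dim : k ≤ n
  strictMono : StrictMono i
  linearIndependent : LinearIndependent ℂ fun j => A.form (i j)
  first : ∀ j, IsLeast {m | A.tailInter i j ⊆ A.hyperplane m} (i j)

/-- The index tuples of the NBC monomials of degree `k`. -/
abbrev NBC (k : ℕ) : Type := {i : Fin k → Fin l // A.IsNBC i}

open Classical in
/-- For `w_1, …, w_n` in `ℂ^l`, let `v_i` be the `i`-th column of the matrix with rows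
`w_1, …, w_n`. The vector attached to a set `S` is the sum of the `v_i` over all `i` with
`S ⊆ H_i`. -/
def decoration (w : Fin n → Fin l → ℂ)
    (S : Set (Projectivization ℂ (Fin (n + 1) → ℂ))) : Fin n → ℂ :=
  ∑ i with S ⊆ A.hyperplane i, fun a => w a i

end ProjArrangement

end

/-!
A descending flag `F` of spaces of linear forms gives a linear map from `ℂ^l` to `ℂ^k` that sends
`x_m` to the indicator vector of `{r | α_m ∈ F_r}`. Among linearly dependent forms two have the
same indicator vector, so the induced map of exterior algebras kills the Orlik-Solomon ideal, and
composing it with the determinant gives a linear functional on the Orlik-Solomon algebra. For the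
flag spanned by the tails of an NBC tuple `i`, the value of this functional at an NBC monomial
`x_j` is a triangular determinant equal to `1` if `j = i`; conversely, a nonzero value forces
`j = i`, because some permutation of `j` is adapted to the flag of `i`. So the functionals form a
system dual to the NBC monomials, and their values on products are the determinants in question.

The NBC monomials span by straightening: if `m < i_j` and `α_m` is a combination of
`α_{i_j}, …, α_{i_k}`, then the relation of the dependent tuple `(m, i_1, …, i_k)` expresses the
monomial `x_i` by monomials in which an index `i_s` with `j ≤ s` is replaced by `m`, all the other
terms having dependent forms.
-/

section LinearAlgebra

theorem sum_neg_one_pow_smul_map_removeNth_eq_zero_of_eq {R M N : Type*} [CommRing R]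
    [AddCommGroup M] [Module R M] [AddCommGroup N] [Module R N] {p : ℕ} (f : M [⋀^Fin p]→ₗ[R] N)
    {v : Fin (p + 1) → M} {a b : Fin (p + 1)} (hv : v a = v b) (hab : a ≠ b) :
    ∑ j : Fin (p + 1), (-1 : ℤ) ^ (j : ℕ) • f (j.removeNth v) = 0 := by
  rw [Fintype.sum_eq_add a b hab fun j ⟨hja, hjb⟩ => ?_]
  · exact f.neg_one_pow_smul_map_removeNth_add_eq_zero_of_eq hv hab
  · obtain ⟨a, rfl⟩ := Fin.exists_succAbove_eq hja.symm
    obtain ⟨b, rfl⟩ := Fin.exists_succAbove_eq hjb.symm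
    rw [f.map_eq_zero_of_eq _ hv (ne_of_apply_ne _ hab), smul_zero]

theorem exists_perm_forall_ne_zero_of_det_ne_zero {ι R : Type*} [Fintype ι] [DecidableEq ι]
    [CommRing R] {M : Matrix ι ι R} (hM : M.det ≠ 0) :
    ∃ σ : Equiv.Perm ι, ∀ r, M (σ r) r ≠ 0 := by
  rw [Matrix.det_apply] at hM
  obtain ⟨σ, -, hσ⟩ := Finset.exists_ne_zero_of_sum_ne_zero hM
  refine ⟨σ, fun r hr => hσ ?_⟩
  have hprod : ∏ s, M (σ s) s = 0 := Finset.prod_eq_zero (Finset.mem_univ r) hr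
  rw [hprod, smul_zero]

variable {K V ι κ : Type*} [DivisionRing K] [AddCommGroup V] [Module K V]

theorem span_range_eq_of_linearIndependent_of_forall_mem [Finite ι] {v w : ι → V}
    (hw : LinearIndependent K w) (h : ∀ a, w a ∈ Submodule.span K (Set.range v)) :
    Submodule.span K (Set.range w) = Submodule.span K (Set.range v) := by
  have := Fintype.ofFinite ι
  have := FiniteDimensional.span_of_finite K (Set.finite_range v)
  refine Submodule.eq_of_le_of_finrank_le (Submodule.span_le.2 (Set.range_subset_iff.2 h)) ?_
  exact (finrank_range_le_card v).trans_eq (finrank_span_eq_card hw).symm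

theorem linearIndependent_of_injective_setOf_mem_chain [LinearOrder κ] {F : κ → Submodule K V}
    (hF : Antitone F) {v : ι → V} (hv : ∀ a, v a ≠ 0)
    (hinj : Function.Injective fun a => {r | v a ∈ F r}) : LinearIndependent K v := by
  classical
  let S : ι → LowerSet κ := fun a => ⟨{r | v a ∈ F r}, fun _ _ hsr hr => hF hsr hr⟩
  rw [linearIndependent_iff']
  by_contra! ⟨s, g, hg, a₀, ha₀, hga₀⟩
  obtain ⟨a, ha, hmin⟩ := (s.filter (g · ≠ 0)).exists_min_image S ⟨a₀, by simp [ha₀, hga₀]⟩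
  rw [Finset.mem_filter] at ha
  obtain ⟨W, haW, hbW⟩ : ∃ W : Submodule K V, v a ∉ W ∧ ∀ b ∈ s.erase a, g b ≠ 0 → v b ∈ W := by
    rcases ((s.erase a).filter (g · ≠ 0)).eq_empty_or_nonempty with hempty | hne
    · exact ⟨⊥, by simpa using hv a, fun b hb hgb =>
        absurd hgb (Finset.filter_eq_empty_iff.1 hempty hb)⟩
    obtain ⟨c, hc, hcmin⟩ := Finset.exists_min_image _ S hne
    simp only [Finset.mem_filter, Finset.mem_erase] at hc hcmin hmin
    have hac : S a ≠ S c := fun h => hc.1.1 (hinj (congrArg SetLike.coe h)).symm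
    obtain ⟨r, hrc, hra⟩ :=
      Set.exists_of_ssubset (LowerSet.coe_ssubset_coe.2 ((hmin c ⟨hc.1.2, hc.2⟩).lt_of_ne hac))
    exact ⟨F r, hra, fun b hb hgb => hcmin b ⟨Finset.mem_erase.1 hb, hgb⟩ hrc⟩
  have hga : g a • v a ∈ W := by
    rw [← Finset.add_sum_erase _ _ ha.1] at hg
    rw [eq_neg_of_add_eq_zero_left hg]
    refine neg_mem (Submodule.sum_mem _ fun b hb => ?_)
    by_cases hgb : g b = 0
    · simp [hgb]
    · exact Submodule.smul_mem _ _ (hbW b hb hgb)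
  exact haW ((Submodule.smul_mem_iff _ ha.2).1 hga)

end LinearAlgebra

section ProjHyperplane

variable {n : ℕ} (Φ : Set (Module.Dual ℂ (Fin (n + 1) → ℂ)))

theorem mk_mem_projHyperplane_iff {f : Module.Dual ℂ (Fin (n + 1) → ℂ)} {v : Fin (n + 1) → ℂ}
    (hv : v ≠ 0) : Projectivization.mk ℂ v hv ∈ projHyperplane f ↔ f v = 0 := by
  rw [projHyperplane, Set.mem_ofPred_eq, Projectivization.submodule_mk,
    Submodule.span_singleton_le_iff_mem, LinearMap.mem_ker]

theorem mk_mem_biInter_projHyperplane_iff {v : Fin (n + 1) → ℂ} (hv : v ≠ 0) :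
    Projectivization.mk ℂ v hv ∈ ⋂ f ∈ Φ, projHyperplane f ↔
      v ∈ (Submodule.span ℂ Φ).dualCoannihilator := by
  simp only [Set.mem_iInter, mk_mem_projHyperplane_iff, ← SetLike.mem_coe,
    Submodule.coe_dualCoannihilator_span, Set.mem_ofPred_eq]

theorem biInter_projHyperplane_subset_iff {f : Module.Dual ℂ (Fin (n + 1) → ℂ)} :
    ⋂ g ∈ Φ, projHyperplane g ⊆ projHyperplane f ↔ f ∈ Submodule.span ℂ Φ := by
  rw [← Subspace.dualCoannihilator_dualAnnihilator_eq (W := Submodule.span ℂ Φ),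
    Submodule.mem_dualAnnihilator]
  constructor
  · intro h v hv
    by_cases hv0 : v = 0
    · rw [hv0, map_zero]
    · exact (mk_mem_projHyperplane_iff hv0).1 (h ((mk_mem_biInter_projHyperplane_iff Φ hv0).2 hv))
  · intro h p
    induction p using Projectivization.ind with
    | h v hv =>
      rw [mk_mem_biInter_projHyperplane_iff, mk_mem_projHyperplane_iff]
      exact h v

theorem biInter_projHyperplane_eq_empty_iff :
    ⋂ f ∈ Φ, projHyperplane f = ∅ ↔ Submodule.span ℂ Φ = ⊤ := by
  rw [Submodule.eq_top_iff']
  refine ⟨fun h f => ?_, fun h => Set.eq_empty_of_forall_notMem fun p => ?_⟩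
  · rw [← biInter_projHyperplane_subset_iff, h]
    exact Set.empty_subset _
  · induction p using Projectivization.ind with
    | h v hv =>
      rw [mk_mem_biInter_projHyperplane_iff, Submodule.mem_dualCoannihilator]
      exact fun hzero => hv ((Module.forall_dual_apply_eq_zero_iff ℂ v).1 fun f => hzero f (h f))

end ProjHyperplane

noncomputable section

namespace ProjArrangement

variable {n l : ℕ} (A : ProjArrangement n l)

section Intersections

variable {k : ℕ} {i : Fin k → Fin l}

theorem inter_subset_hyperplane_iff {m : Fin l} :
    A.inter i ⊆ A.hyperplane m ↔ A.form m ∈ Submodule.span ℂ (Set.range (A.form ∘ i)) := by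
  rw [← biInter_projHyperplane_subset_iff, Set.biInter_range]
  rfl

theorem inter_eq_empty_iff :
    A.inter i = ∅ ↔ Submodule.span ℂ (Set.range (A.form ∘ i)) = ⊤ := by
  rw [← biInter_projHyperplane_eq_empty_iff, Set.biInter_range]
  rfl

theorem lt_of_inter_eq_empty (hi : A.inter i = ∅) : n < k := by
  have hcard := finrank_range_le_card (R := ℂ) (A.form ∘ i)
  rw [Set.finrank, A.inter_eq_empty_iff.1 hi, finrank_top, Subspace.dual_finrank_eq,
    Module.finrank_fin_fun, Fintype.card_fin] at hcard
  exact hcard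

theorem le_of_linearIndependent_of_inter_nonempty (hi : LinearIndependent ℂ (A.form ∘ i))
    (hne : (A.inter i).Nonempty) : k ≤ n := by
  have hk : k ≤ n + 1 := by simpa using hi.fintype_card_le_finrank
  refine Nat.le_of_lt_succ (hk.lt_of_ne fun hk => hne.ne_empty ?_)
  exact A.inter_eq_empty_iff.2 (hi.span_eq_top_of_card_eq_finrank' (by simp [hk]))

theorem nonGeneric_cons {m : Fin l} (hne : (A.inter i).Nonempty)
    (hm : A.form m ∈ Submodule.span ℂ (Set.range (A.form ∘ i))) :
    A.NonGeneric (Fin.cons m i : Fin (k + 1) → Fin l) := by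
  constructor
  · obtain ⟨p, hp⟩ := hne
    refine ⟨p, Set.mem_iInter.2 (Fin.cases ?_ fun r => ?_)⟩
    · exact A.inter_subset_hyperplane_iff.2 hm hp
    · exact Set.mem_iInter.1 hp r
  · change ¬ LinearIndependent ℂ (A.form ∘ Fin.cons m i)
    rw [Fin.comp_cons, linearIndependent_finCons]
    exact fun h => h.2 hm

variable (i) in
/-- The span of the forms of the tail `H_{i_r}, …, H_{i_k}`: the linear forms vanishing on
`A.tailInter i r`. For varying `r` these spaces make up the flag of the tuple `i`. -/
def tailSpan (r : Fin k) : Submodule ℂ (Module.Dual ℂ (Fin (n + 1) → ℂ)) :=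
  Submodule.span ℂ (A.form ∘ i '' Set.Ici r)

theorem tailInter_subset_hyperplane_iff {r : Fin k} {m : Fin l} :
    A.tailInter i r ⊆ A.hyperplane m ↔ A.form m ∈ A.tailSpan i r := by
  rw [tailSpan, ← biInter_projHyperplane_subset_iff, Set.biInter_image]
  rfl

variable (i) in
theorem tailSpan_antitone : Antitone (A.tailSpan i) := fun _ _ h =>
  Submodule.span_mono (Set.image_mono (Set.Ici_subset_Ici.2 h))

theorem form_mem_tailSpan {r s : Fin k} (h : r ≤ s) : A.form (i s) ∈ A.tailSpan i r :=
  Submodule.subset_span ⟨s, h, rfl⟩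

theorem tailSpan_le_span_range (r : Fin k) :
    A.tailSpan i r ≤ Submodule.span ℂ (Set.range (A.form ∘ i)) :=
  Submodule.span_mono (Set.image_subset_range _ _)

theorem tailSpan_eq_of_forall_mem {j : Fin k → Fin l} (hj : LinearIndependent ℂ (A.form ∘ j))
    (h : ∀ r, A.form (j r) ∈ A.tailSpan i r) (r : Fin k) : A.tailSpan j r = A.tailSpan i r := by
  have hj' : LinearIndependent ℂ fun s : Set.Ici r => (A.form ∘ j) s :=
    hj.comp _ Subtype.val_injective
  rw [tailSpan, tailSpan, Set.image_eq_range, Set.image_eq_range]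
  refine span_range_eq_of_linearIndependent_of_forall_mem hj' fun s => ?_
  rw [← Set.image_eq_range]
  exact A.tailSpan_antitone i s.2 (h s)

end Intersections

section ExteriorMonomials

theorem ι_mul_extMonomial {k : ℕ} (m : Fin l) (i : Fin k → Fin l) :
    ExteriorAlgebra.ι ℂ (Pi.single m 1) * extMonomial i =
      extMonomial (Fin.cons m i : Fin (k + 1) → Fin l) := by
  rw [extMonomial, extMonomial, ExteriorAlgebra.ιMulti_succ_apply]
  rfl

theorem extMonomial_comp_perm {k : ℕ} (i : Fin k → Fin l) (σ : Equiv.Perm (Fin k)) :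
    extMonomial (i ∘ σ) = Equiv.Perm.sign σ • extMonomial i := by
  rw [extMonomial, extMonomial, ← AlternatingMap.map_perm]
  rfl

theorem extMonomial_eq_zero_of_not_injective {k : ℕ} {i : Fin k → Fin l}
    (hi : ¬ Function.Injective i) : extMonomial i = 0 := by
  obtain ⟨a, b, hab, hne⟩ := Function.not_injective_iff.1 hi
  exact (ExteriorAlgebra.ιMulti ℂ k).map_eq_zero_of_eq _ (by simp only [hab]) hne

theorem map_extBoundary_eq_zero_of_eq {M : Type*} [AddCommGroup M] [Module ℂ M] {p : ℕ}
    (f : (Fin l → ℂ) →ₗ[ℂ] M) {i : Fin (p + 1) → Fin l} {a b : Fin (p + 1)} (hab : a ≠ b)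
    (h : f (Pi.single (i a) 1) = f (Pi.single (i b) 1)) :
    ExteriorAlgebra.map f (extBoundary i) = 0 := by
  have hsum := sum_neg_one_pow_smul_map_removeNth_eq_zero_of_eq (ExteriorAlgebra.ιMulti ℂ p)
    (v := fun j => f (Pi.single (i j) 1)) h hab
  rw [← neg_eq_zero, ← Finset.sum_neg_distrib] at hsum
  rw [extBoundary, map_sum, ← hsum]
  refine Finset.sum_congr rfl fun j _ => ?_
  rw [map_smul, extMonomial, ExteriorAlgebra.map_apply_ιMulti, pow_succ, mul_neg_one, neg_smul,
    ← Int.cast_smul_eq_zsmul ℂ]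
  push_cast
  rfl

theorem extBoundary_eq_zero_of_not_injective {p : ℕ} {i : Fin (p + 1) → Fin l}
    (hi : ¬ Function.Injective i) : extBoundary i = 0 := by
  obtain ⟨a, b, hab, hne⟩ := Function.not_injective_iff.1 hi
  simpa only [ExteriorAlgebra.map_id, AlgHom.id_apply] using
    map_extBoundary_eq_zero_of_eq LinearMap.id hne (by rw [hab])

theorem extBoundary_cons {k : ℕ} (m : Fin l) (i : Fin (k + 1) → Fin l) :
    extBoundary (Fin.cons m i : Fin (k + 2) → Fin l) =
      -extMonomial i - ExteriorAlgebra.ι ℂ (Pi.single m 1) * extBoundary i := by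
  have hcons : ∀ s : Fin (k + 1), (fun r => (Fin.cons m i : Fin (k + 2) → Fin l)
      (s.succ.succAbove r)) = Fin.cons m fun r => i (s.succAbove r) := fun s => by
    ext r : 1
    cases r using Fin.cases <;> simp only [Fin.succ_succAbove_zero, Fin.succ_succAbove_succ,
      Fin.cons_zero, Fin.cons_succ]
  rw [extBoundary, Fin.sum_univ_succ, extBoundary, Finset.mul_sum, sub_eq_add_neg,
    ← Finset.sum_neg_distrib]
  congr 1
  · simp
  · refine Finset.sum_congr rfl fun s _ => ?_
    rw [hcons, mul_smul_comm, ι_mul_extMonomial, Fin.val_succ, pow_succ, mul_neg_one, neg_smul]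

theorem ι_mul_extBoundary {p : ℕ} (i : Fin (p + 1) → Fin l) :
    ExteriorAlgebra.ι ℂ (Pi.single (i 0) 1) * extBoundary i = -extMonomial i := by
  have htail : extMonomial i =
      ExteriorAlgebra.ι ℂ (Pi.single (i 0) 1) * extMonomial (Fin.tail i) := by
    rw [ι_mul_extMonomial, Fin.cons_self_tail]
  cases p with
  | zero =>
    rw [htail]
    simp [extBoundary, extMonomial]
  | succ p =>
    conv_lhs => rw [← Fin.cons_self_tail i, Fin.cons_zero, extBoundary_cons]
    rw [mul_sub, ← mul_assoc, ExteriorAlgebra.ι_sq_zero, zero_mul, sub_zero, mul_neg, htail]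

end ExteriorMonomials

section Relations

theorem toOS_eq_zero_of_mem {y : ExteriorAlgebra ℂ (Fin l → ℂ)} (hy : y ∈ A.osIdeal) :
    A.toOS y = 0 :=
  (RingCon.eq _).2 hy

theorem toOS_smul (c : ℂ) (y : ExteriorAlgebra ℂ (Fin l → ℂ)) : A.toOS (c • y) = c • A.toOS y :=
  rfl

theorem toOS_extBoundary {p : ℕ} {i : Fin (p + 1) → Fin l} (hi : A.NonGeneric i) :
    A.toOS (extBoundary i) = 0 := by
  by_cases hinj : Function.Injective i
  · exact A.toOS_eq_zero_of_mem (TwoSidedIdeal.subset_span (Or.inl ⟨p, i, hinj, hi, rfl⟩))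
  · rw [extBoundary_eq_zero_of_not_injective hinj, map_zero]

variable {k : ℕ} {i : Fin k → Fin l}

theorem monomial_eq_toOS_extMonomial (i : Fin k → Fin l) :
    A.monomial i = A.toOS (extMonomial i) :=
  rfl

theorem monomial_eq_zero_of_not_injective (hi : ¬ Function.Injective i) : A.monomial i = 0 := by
  rw [monomial_eq_toOS_extMonomial, extMonomial_eq_zero_of_not_injective hi, map_zero]

theorem monomial_eq_zero_of_inter_eq_empty (hi : A.inter i = ∅) : A.monomial i = 0 := by
  by_cases hinj : Function.Injective i
  · exact A.toOS_eq_zero_of_mem (TwoSidedIdeal.subset_span (Or.inr ⟨k, i, hinj, hi, rfl⟩))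
  · exact A.monomial_eq_zero_of_not_injective hinj

theorem monomial_eq_zero_of_not_linearIndependent (hi : ¬ LinearIndependent ℂ (A.form ∘ i)) :
    A.monomial i = 0 := by
  rcases (A.inter i).eq_empty_or_nonempty with hempty | hne
  · exact A.monomial_eq_zero_of_inter_eq_empty hempty
  cases k with
  | zero => exact absurd linearIndependent_empty_type hi
  | succ p =>
    rw [monomial_eq_toOS_extMonomial, ← neg_eq_zero, ← map_neg, ← ι_mul_extBoundary, map_mul,
      A.toOS_extBoundary ⟨hne, hi⟩, mul_zero]

theorem monomial_comp_perm_mem_iff (i : Fin k → Fin l) (σ : Equiv.Perm (Fin k))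
    (S : Submodule ℂ A.OSAlgebra) : A.monomial (i ∘ σ) ∈ S ↔ A.monomial i ∈ S := by
  simp only [monomial_eq_toOS_extMonomial, extMonomial_comp_perm]
  rcases Int.units_eq_one_or (Equiv.Perm.sign σ) with h | h
  · rw [h, one_smul]
  · rw [h, Units.neg_smul, one_smul, map_neg, neg_mem_iff]

theorem monomial_eq_sum_cons {i : Fin (k + 1) → Fin l} {m : Fin l}
    (h : A.NonGeneric (Fin.cons m i : Fin (k + 2) → Fin l)) :
    A.monomial i = ∑ s : Fin (k + 1), (-1 : ℂ) ^ (s : ℕ) •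
      A.monomial (Fin.cons m (i ∘ s.succAbove) : Fin (k + 1) → Fin l) := by
  have hrel := A.toOS_extBoundary h
  rw [extBoundary_cons, map_sub, map_neg, sub_eq_zero, neg_eq_iff_eq_neg] at hrel
  rw [monomial_eq_toOS_extMonomial, hrel, extBoundary, Finset.mul_sum, map_sum,
    ← Finset.sum_neg_distrib]
  refine Finset.sum_congr rfl fun s _ => ?_
  rw [mul_smul_comm, ι_mul_extMonomial, toOS_smul, pow_succ, mul_neg_one, neg_smul, neg_neg]
  rfl

end Relations

section Spanning

variable {k : ℕ} {i : Fin k → Fin l}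

theorem isNBC_of_forall_le (hk : k ≤ n) (hmono : StrictMono i)
    (hi : LinearIndependent ℂ (A.form ∘ i))
    (hle : ∀ r m, A.form m ∈ A.tailSpan i r → i r ≤ m) : A.IsNBC i := by
  refine ⟨hk, hmono, hi, fun r => ?_⟩
  simp only [tailInter_subset_hyperplane_iff]
  exact ⟨A.form_mem_tailSpan le_rfl, fun m => hle r m⟩

theorem sum_cons_succAbove_lt {i : Fin (k + 1) → Fin l} {m : Fin l} {s : Fin (k + 1)}
    (hm : m < i s) :
    ∑ r, ((Fin.cons m (i ∘ s.succAbove) : Fin (k + 1) → Fin l) r : ℕ) < ∑ r, (i r : ℕ) := by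
  rw [Fin.sum_univ_succ, Fin.sum_univ_succAbove (fun r => (i r : ℕ)) s]
  simp only [Fin.cons_zero, Fin.cons_succ, Function.comp_apply]
  exact Nat.add_lt_add_right hm _

theorem not_linearIndependent_cons_succAbove {i : Fin (k + 1) → Fin l} {m : Fin l}
    {r s : Fin (k + 1)} (hm : A.form m ∈ A.tailSpan i r) (hs : s < r) :
    ¬ LinearIndependent ℂ (A.form ∘ (Fin.cons m (i ∘ s.succAbove) : Fin (k + 1) → Fin l)) := by
  rw [Fin.comp_cons, linearIndependent_finCons]
  refine fun h => h.2 (Submodule.span_mono ?_ hm)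
  rintro _ ⟨t, ht, rfl⟩
  obtain ⟨q, rfl⟩ := Fin.exists_succAbove_eq (hs.trans_le ht).ne'
  exact ⟨q, rfl⟩

theorem monomial_mem_span_sum_lt (hmono : Monotone i) (hne : (A.inter i).Nonempty) {m : Fin l}
    {r : Fin k} (hlt : m < i r) (hm : A.form m ∈ A.tailSpan i r) :
    A.monomial i ∈ Submodule.span ℂ
      (A.monomial '' {c : Fin k → Fin l | ∑ s, (c s : ℕ) < ∑ s, (i s : ℕ)}) := by
  cases k with
  | zero => exact r.elim0
  | succ k =>
    rw [A.monomial_eq_sum_cons (A.nonGeneric_cons hne (A.tailSpan_le_span_range r hm))]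
    refine Submodule.sum_mem _ fun s _ => Submodule.smul_mem _ _ ?_
    rcases lt_or_ge s r with hsr | hrs
    · rw [A.monomial_eq_zero_of_not_linearIndependent
        (A.not_linearIndependent_cons_succAbove hm hsr)]
      exact zero_mem _
    · exact Submodule.subset_span
        ⟨_, sum_cons_succAbove_lt (hlt.trans_le (hmono hrs)), rfl⟩

theorem monomial_mem_span_nbc (i : Fin k → Fin l) :
    A.monomial i ∈ Submodule.span ℂ (Set.range fun I : Σ k : ℕ, A.NBC k => A.monomial I.2.1) := by
  induction hN : ∑ r, (i r : ℕ) using Nat.strong_induction_on generalizing i with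
  | _ N ih =>
  wlog hmono : Monotone i generalizing i
  · rw [← A.monomial_comp_perm_mem_iff i (Tuple.sort i)]
    refine this _ ?_ (Tuple.monotone_sort i)
    rw [← hN]
    exact Equiv.sum_comp (Tuple.sort i) fun r => (i r : ℕ)
  by_cases hzero : A.monomial i = 0
  · rw [hzero]
    exact zero_mem _
  have hinj : Function.Injective i := not_imp_comm.1 A.monomial_eq_zero_of_not_injective hzero
  have hi : LinearIndependent ℂ (A.form ∘ i) :=
    not_imp_comm.1 A.monomial_eq_zero_of_not_linearIndependent hzero
  have hne : (A.inter i).Nonempty :=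
    Set.nonempty_iff_ne_empty.2 (mt A.monomial_eq_zero_of_inter_eq_empty hzero)
  by_cases hle : ∀ r m, A.form m ∈ A.tailSpan i r → i r ≤ m
  · have hnbc : A.IsNBC i :=
      A.isNBC_of_forall_le (A.le_of_linearIndependent_of_inter_nonempty hi hne)
        (hmono.strictMono_of_injective hinj) hi hle
    exact Submodule.subset_span ⟨⟨k, i, hnbc⟩, rfl⟩
  · push Not at hle
    obtain ⟨r, m, hm, hlt⟩ := hle
    refine Submodule.span_le.2 ?_ (A.monomial_mem_span_sum_lt hmono hne hlt hm)
    rintro _ ⟨c, hc, rfl⟩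
    exact ih _ (hN ▸ hc) c rfl

theorem wedge_eq_sum_monomial (w : Fin k → Fin l → ℂ) :
    A.wedge w = ∑ c : Fin k → Fin l, (∏ r, w r (c r)) • A.monomial c := by
  conv_lhs => rw [wedge, funext fun r => pi_eq_sum_univ' (w r), ← AlternatingMap.coe_multilinearMap,
    MultilinearMap.map_sum, map_sum]
  refine Finset.sum_congr rfl fun c _ => ?_
  rw [MultilinearMap.map_smul_univ, toOS_smul]
  rfl

theorem span_nbc_monomial_eq_top :
    Submodule.span ℂ (Set.range fun I : Σ k : ℕ, A.NBC k => A.monomial I.2.1) = ⊤ := by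
  have hsurj : (A.osIdeal.ringCon.mkₐ ℂ).toLinearMap.range = ⊤ :=
    LinearMap.range_eq_top.2 (RingCon.mkₐ_surjective (α := ℂ) _)
  rw [eq_top_iff, ← hsurj, LinearMap.range_eq_map, ← ExteriorAlgebra.ιMulti_span,
    Submodule.map_span_le]
  rintro _ ⟨⟨k, w⟩, rfl⟩
  change A.wedge w ∈ _
  rw [wedge_eq_sum_monomial]
  exact Submodule.sum_mem _ fun c _ => Submodule.smul_mem _ _ (A.monomial_mem_span_nbc c)

end Spanning

section Flag

variable {k : ℕ}

open Classical in
/-- The linear map `ℂ^l → ℂ^k` attached to a flag `F` of spaces of linear forms: it sends `x_m` to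
the indicator vector of the set of all `r` such that `F r` contains the form of `H_m`. -/
def flagMap (F : Fin k → Submodule ℂ (Module.Dual ℂ (Fin (n + 1) → ℂ))) :
    (Fin l → ℂ) →ₗ[ℂ] (Fin k → ℂ) :=
  LinearMap.pi fun r => ∑ m with A.form m ∈ F r, LinearMap.proj m

variable {F : Fin k → Submodule ℂ (Module.Dual ℂ (Fin (n + 1) → ℂ))}

open Classical in
theorem flagMap_apply (x : Fin l → ℂ) (r : Fin k) :
    A.flagMap F x r = ∑ m with A.form m ∈ F r, x m := by
  rw [flagMap, LinearMap.pi_apply, LinearMap.sum_apply]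
  rfl

open Classical in
theorem flagMap_single (m : Fin l) (r : Fin k) :
    A.flagMap F (Pi.single m 1) r = if A.form m ∈ F r then 1 else 0 := by
  simp [flagMap_apply]

theorem exists_flagMap_single_eq_of_not_linearIndependent (hF : Antitone F) {m : ℕ}
    {c : Fin m → Fin l} (hc : ¬ LinearIndependent ℂ (A.form ∘ c)) :
    ∃ a b, a ≠ b ∧ A.flagMap F (Pi.single (c a) 1) = A.flagMap F (Pi.single (c b) 1) := by
  obtain ⟨a, b, hab, hne⟩ := Function.not_injective_iff.1 (mt
    (linearIndependent_of_injective_setOf_mem_chain hF fun a => A.form_ne_zero (c a)) hc)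
  refine ⟨a, b, hne, funext fun r => ?_⟩
  have hr : A.form (c a) ∈ F r ↔ A.form (c b) ∈ F r := Set.ext_iff.1 hab r
  classical simp only [flagMap_single, hr]

theorem osIdeal_le_ker_map_flagMap (hF : Antitone F) (hk : k ≤ n) :
    A.osIdeal ≤ TwoSidedIdeal.ker (ExteriorAlgebra.map (A.flagMap F)) := by
  refine TwoSidedIdeal.span_le.2 ?_
  rintro _ (⟨p, c, -, hc, rfl⟩ | ⟨m, c, -, hc, rfl⟩) <;>
    rw [SetLike.mem_coe, TwoSidedIdeal.mem_ker]
  · obtain ⟨a, b, hne, hab⟩ := A.exists_flagMap_single_eq_of_not_linearIndependent hF hc.2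
    exact map_extBoundary_eq_zero_of_eq _ hne hab
  · rw [extMonomial, ExteriorAlgebra.map_apply_ιMulti]
    refine AlternatingMap.map_linearDependent _ _ fun hli => ?_
    have hmk : m ≤ k := by simpa using hli.fintype_card_le_finrank
    exact (A.lt_of_inter_eq_empty hc).not_ge (hmk.trans hk)

/-- The algebra homomorphism from the Orlik-Solomon algebra to the exterior algebra of `ℂ^k`
induced by `flagMap`. -/
def flagHom (hF : Antitone F) (hk : k ≤ n) : A.OSAlgebra →ₐ[ℂ] ExteriorAlgebra ℂ (Fin k → ℂ) :=
  A.osIdeal.ringCon.liftₐ (ExteriorAlgebra.map (A.flagMap F))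
    fun _ _ h => (TwoSidedIdeal.ker_ringCon _).1
      (TwoSidedIdeal.ringCon_le_iff.1 (A.osIdeal_le_ker_map_flagMap hF hk) h)

/-- The linear functional on the Orlik-Solomon algebra attached to a flag: the determinant on the
degree `k` part of the image under `flagHom`, and zero on the parts of other degrees. -/
def flagCoeff (hF : Antitone F) (hk : k ≤ n) : A.OSAlgebra →ₗ[ℂ] ℂ :=
  ExteriorAlgebra.liftAlternating (Pi.single k Matrix.detRowAlternating) ∘ₗ
    (A.flagHom hF hk).toLinearMap

theorem flagHom_wedge (hF : Antitone F) (hk : k ≤ n) {m : ℕ} (w : Fin m → Fin l → ℂ) :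
    A.flagHom hF hk (A.wedge w) = ExteriorAlgebra.ιMulti ℂ m (A.flagMap F ∘ w) :=
  ExteriorAlgebra.map_apply_ιMulti _ _

theorem flagCoeff_wedge (hF : Antitone F) (hk : k ≤ n) (w : Fin k → Fin l → ℂ) :
    A.flagCoeff hF hk (A.wedge w) = Matrix.det (Matrix.of fun a => A.flagMap F (w a)) := by
  rw [flagCoeff, LinearMap.comp_apply, AlgHom.toLinearMap_apply, flagHom_wedge,
    ExteriorAlgebra.liftAlternating_apply_ιMulti, Pi.single_eq_same]
  rfl

theorem flagCoeff_wedge_of_ne (hF : Antitone F) (hk : k ≤ n) {m : ℕ} (hkm : k ≠ m)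
    (w : Fin m → Fin l → ℂ) : A.flagCoeff hF hk (A.wedge w) = 0 := by
  rw [flagCoeff, LinearMap.comp_apply, AlgHom.toLinearMap_apply, flagHom_wedge,
    ExteriorAlgebra.liftAlternating_apply_ιMulti, Pi.single_eq_of_ne hkm.symm]
  rfl

end Flag

namespace IsNBC

variable {A} {k : ℕ} {i j : Fin k → Fin l}

theorem isLeast (hi : A.IsNBC i) (r : Fin k) : IsLeast {m | A.form m ∈ A.tailSpan i r} (i r) := by
  simpa only [tailInter_subset_hyperplane_iff] using hi.first r

theorem mem_range_of_forall_mem_tailSpan (hi : A.IsNBC i) (hj : A.IsNBC j)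
    {σ : Equiv.Perm (Fin k)} (h : ∀ r, A.form (j (σ r)) ∈ A.tailSpan i r) (r : Fin k) :
    i r ∈ Set.range j := by
  obtain ⟨s, hs, hmin⟩ := Set.exists_min_image (Set.Ici r) σ (Set.toFinite _) Set.nonempty_Ici
  have hij : i r ≤ j (σ s) := (hi.isLeast r).2 (A.tailSpan_antitone i hs (h s))
  have hji : j (σ s) ≤ i r := by
    have hspan : A.tailSpan (j ∘ σ) r = A.tailSpan i r :=
      A.tailSpan_eq_of_forall_mem (hj.linearIndependent.comp σ σ.injective) h r
    have hmem : A.form (i r) ∈ A.tailSpan (j ∘ σ) r := hspan ▸ A.form_mem_tailSpan le_rfl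
    refine (hj.isLeast (σ s)).2 (Submodule.span_mono ?_ hmem)
    rintro _ ⟨t, ht, rfl⟩
    exact ⟨σ t, hmin t ht, rfl⟩
  exact ⟨σ s, hji.antisymm hij⟩

theorem eq_of_forall_mem_tailSpan (hi : A.IsNBC i) (hj : A.IsNBC j) {σ : Equiv.Perm (Fin k)}
    (h : ∀ r, A.form (j (σ r)) ∈ A.tailSpan i r) : i = j := by
  have hsub : Set.range i ⊆ Set.range j :=
    Set.range_subset_iff.2 (hi.mem_range_of_forall_mem_tailSpan hj h)
  refine (StrictMono.range_inj hi.strictMono hj.strictMono).1 (Set.eq_of_subset_of_ncard_le hsub ?_)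
  rw [Set.ncard_range_of_injective hi.strictMono.injective,
    Set.ncard_range_of_injective hj.strictMono.injective]

theorem flagCoeff_monomial_self (hi : A.IsNBC i) :
    A.flagCoeff (A.tailSpan_antitone i) hi.le_dim (A.monomial i) = 1 := by
  rw [monomial, flagCoeff_wedge, Matrix.det_of_isLowerTriangular]
  · exact Finset.prod_eq_one fun r _ =>
      (A.flagMap_single (i r) r).trans (if_pos (A.form_mem_tailSpan le_rfl))
  · intro s r hsr
    exact (A.flagMap_single (i s) r).trans
      (if_neg fun h => (hi.strictMono hsr).not_ge ((hi.isLeast r).2 h))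

theorem flagCoeff_monomial_of_ne (hi : A.IsNBC i) (hj : A.IsNBC j) (hij : i ≠ j) :
    A.flagCoeff (A.tailSpan_antitone i) hi.le_dim (A.monomial j) = 0 := by
  by_contra hne
  rw [monomial, flagCoeff_wedge] at hne
  obtain ⟨σ, hσ⟩ := exists_perm_forall_ne_zero_of_det_ne_zero hne
  refine hij (hi.eq_of_forall_mem_tailSpan hj (σ := σ) fun r => ?_)
  by_contra hr
  exact hσ r ((A.flagMap_single (j (σ r)) r).trans (if_neg hr))

end IsNBC

section Basis

/-- The functional dual to the NBC monomial `I`: the one attached to the flag of the tails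
of `I`. -/
def nbcCoeff (I : Σ k : ℕ, A.NBC k) : A.OSAlgebra →ₗ[ℂ] ℂ :=
  A.flagCoeff (A.tailSpan_antitone I.2.1) I.2.2.le_dim

theorem nbcCoeff_monomial_self (I : Σ k : ℕ, A.NBC k) : A.nbcCoeff I (A.monomial I.2.1) = 1 :=
  I.2.2.flagCoeff_monomial_self

theorem nbcCoeff_monomial_of_ne {I J : Σ k : ℕ, A.NBC k} (hIJ : I ≠ J) :
    A.nbcCoeff I (A.monomial J.2.1) = 0 := by
  obtain ⟨k, i, hi⟩ := I
  obtain ⟨m, j, hj⟩ := J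
  obtain rfl | hkm := eq_or_ne k m
  · exact hi.flagCoeff_monomial_of_ne hj fun hij => hIJ (by subst hij; rfl)
  · exact A.flagCoeff_wedge_of_ne _ _ hkm _

theorem linearIndependent_nbc_monomial :
    LinearIndependent ℂ fun I : Σ k : ℕ, A.NBC k => A.monomial I.2.1 :=
  LinearIndependent.of_pairwise_dual_eq_zero_one _ A.nbcCoeff
    (fun _ _ hIJ => A.nbcCoeff_monomial_of_ne hIJ) A.nbcCoeff_monomial_self

/-- The basis of NBC monomials of the Orlik-Solomon algebra. -/
def nbcBasis : Module.Basis (Σ k : ℕ, A.NBC k) ℂ A.OSAlgebra :=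
  Module.Basis.mk A.linearIndependent_nbc_monomial A.span_nbc_monomial_eq_top.ge

theorem nbcBasis_apply (I : Σ k : ℕ, A.NBC k) : A.nbcBasis I = A.monomial I.2.1 :=
  Module.Basis.mk_apply _ _ I

theorem nbcBasis_coord (I : Σ k : ℕ, A.NBC k) : A.nbcBasis.coord I = A.nbcCoeff I := by
  refine A.nbcBasis.ext fun J => ?_
  rw [nbcBasis_apply]
  obtain rfl | hIJ := eq_or_ne I J
  · rw [nbcCoeff_monomial_self, ← nbcBasis_apply, Module.Basis.coord_apply,
      Module.Basis.repr_self, Finsupp.single_eq_same]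
  · rw [A.nbcCoeff_monomial_of_ne hIJ, ← nbcBasis_apply, Module.Basis.coord_apply,
      Module.Basis.repr_self, Finsupp.single_eq_of_ne hIJ]

open Classical in
theorem nbcBasis_repr_wedge {k : ℕ} (w : Fin k → Fin l → ℂ) (i : A.NBC k) :
    A.nbcBasis.repr (A.wedge w) ⟨k, i⟩ = Matrix.det (Matrix.of fun a r : Fin k =>
      ∑ m with A.tailInter i.1 r ⊆ A.hyperplane m, w a m) := by
  simp only [tailInter_subset_hyperplane_iff, ← flagMap_apply]
  rw [← Module.Basis.coord_apply, nbcBasis_coord]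
  exact A.flagCoeff_wedge _ _ w

theorem nbcBasis_repr_wedge_of_ne {k : ℕ} (w : Fin k → Fin l → ℂ) {I : Σ k : ℕ, A.NBC k}
    (hI : I.1 ≠ k) : A.nbcBasis.repr (A.wedge w) I = 0 := by
  rw [← Module.Basis.coord_apply, nbcBasis_coord]
  exact A.flagCoeff_wedge_of_ne _ _ hI w

end Basis

end ProjArrangement

end

open Classical in
theorem mainTheorem5_general (n l : ℕ) (A : ProjArrangement n l) :
    ∃ b : Module.Basis (Σ k : ℕ, A.NBC k) ℂ A.OSAlgebra,
      (∀ I, b I = A.monomial I.2.1) ∧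
      ∀ (k : ℕ) (w : Fin k → Fin l → ℂ),
        (∀ i : A.NBC k, b.repr (A.wedge w) ⟨k, i⟩ = Matrix.det (Matrix.of fun a r : Fin k =>
          ∑ m with A.tailInter i.1 r ⊆ A.hyperplane m, w a m)) ∧
        (∀ I : Σ k : ℕ, A.NBC k, I.1 ≠ k → b.repr (A.wedge w) I = 0) :=
  ⟨A.nbcBasis, A.nbcBasis_apply, fun _ w =>
    ⟨A.nbcBasis_repr_wedge w, fun _ hI => A.nbcBasis_repr_wedge_of_ne w hI⟩⟩

/-- The NBC monomials form a basis of the Orlik-Solomon algebra, and in the expansion of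
`w_1 ∧ ⋯ ∧ w_n` in this basis the coefficient of `x_{i_1} ∧ ⋯ ∧ x_{i_n}` is the determinant whose
`k`-th column is the sum of the `v_i` over all `H_i` containing `H_{i_k} ∩ ⋯ ∩ H_{i_n}`; the
coefficients of the NBC monomials of other degrees vanish. -/
theorem mainTheorem5 (n l : ℕ) (A : ProjArrangement n l) :
    ∃ b : Module.Basis (Σ k : ℕ, A.NBC k) ℂ A.OSAlgebra,
      (∀ I, b I = A.monomial I.2.1) ∧
      ∀ w : Fin n → Fin l → ℂ,
        (∀ i : A.NBC n, b.repr (A.wedge w) ⟨n, i⟩ =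
          Matrix.det (Matrix.of fun a k : Fin n => A.decoration w (A.tailInter i.1 k) a)) ∧
        (∀ I : Σ k : ℕ, A.NBC k, I.1 ≠ n → b.repr (A.wedge w) I = 0) := by
  obtain ⟨b, hb, hrepr⟩ := mainTheorem5_general n l A
  refine ⟨b, hb, fun w => ?_⟩
  simpa only [ProjArrangement.decoration, Finset.sum_apply] using hrepr n w
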